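/- Let $0<r<1$, $\alpha>0$, $\beta\in\mathbb{R}$. For $1\le s<\infty$ write $\|f\|_{s}=\big(\int_{0}^{2\pi}|f(t)|^{s}\,dt\big)^{1/s}$ for $2\pi$-periodic real functions $f$. Let $$P_{\alpha,r,\beta}(t)=\sum_{k=1}^{\infty}e^{-\alpha k^{r}}\cos\Big(kt-\frac{\beta\pi}{2}\Big),$$ and let $C^{\alpha,r}_{\beta,1}$ be the set of all functions $f$ of the form $$f(x)=\frac{a_0}{2}+\frac1\pi\int_{-\pi}^{\pi}P_{\alpha,r,\beta}(x-t)\varphi(t)\,dt\qquad(x\in\mathbb{R}),$$ where $a_0\in\mathbb{R}$ and $\varphi$ is a real $2\pi$-periodic function, integrable over a period, with $\|\varphi\|_{1}\le 1$ and $\int_{-\pi}^{\pi}\varphi(t)\,dt=0$. For $n\ge 1$ put $$\mathcal{E}_n(C^{\alpha,r}_{\beta,1})_2=\sup_{f\in C^{\alpha,r}_{\beta,1}}\|f-S_{n-1}(f)\|_{2},$$ where $S_{n-1}(f)$ is the partial Fourier sum of $f$ of order $n-1$. Let $n_0(\alpha,r,2)$ be the smallest positive integer $n$ such that $$\frac{1}{\alpha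 r}\frac{1}{n^{r}}+\frac{2\alpha r}{n^{1-r}}\le\frac{1}{2(3\pi)^{3}}.$$ Then for every integer $n\ge n_0(\alpha,r,2)$ the quantity $\mathcal{E}_n(C^{\alpha,r}_{\beta,1})_2$ is finite and $$\mathcal{E}_n(C^{\alpha,r}_{\beta,1})_2=\frac{e^{-\alpha n^{r}}}{\sqrt{2\pi\alpha r}}\,n^{\frac{1-r}{2}}\bigg(1+\gamma_n\Big(\big(\alpha r+\sqrt{\alpha r}\big)\frac{1}{n^{\frac{1-r}{2}}}+\frac{\sqrt2}{\alpha r}\frac{1}{n^{r}}\Big)\bigg)$$ for some real number $\gamma_n=\gamma_n(\alpha,r,\beta)$ with $|\gamma_n|\le 392\,\pi^{5/2}$. -/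

import Mathlib

open scoped ENNReal

noncomputable section

namespace GenPoisson

/-- Lebesgue measure on one period `[0, 2π)`. -/
def periodMeasure : MeasureTheory.Measure ℝ :=
  MeasureTheory.volume.restrict (Set.Ico 0 (2 * Real.pi))

/-- The (not normalized) norm of the space `L_s` of `2π`-periodic functions,
`‖f‖_s = (∫_0^{2π} |f|^s)^{1/s}` for `s < ∞` and the essential supremum for `s = ∞`. -/
def periodNorm (s : ℝ≥0∞) (f : ℝ → ℝ) : ℝ≥0∞ :=
  MeasureTheory.eLpNorm f s periodMeasure

/-- The generalized Poisson kernel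
`P_{α,r,β}(t) = ∑_{k ≥ 1} e^{-α k^r} cos (k t - β π / 2)`. -/
def kernel (α r β t : ℝ) : ℝ :=
  ∑' k : ℕ, Real.exp (-α * ((k + 1 : ℕ) : ℝ) ^ r) *
    Real.cos (((k + 1 : ℕ) : ℝ) * t - β * Real.pi / 2)

/-- The set `B_p^0` of real `2π`-periodic functions `φ ∈ L_p` with `‖φ‖_p ≤ 1` and
mean value zero. -/
def unitBallZeroMean (p : ℝ≥0∞) : Set (ℝ → ℝ) :=
  {φ | Function.Periodic φ (2 * Real.pi) ∧
    MeasureTheory.MemLp φ p periodMeasure ∧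
    periodNorm p φ ≤ 1 ∧
    ∫ t in (-Real.pi)..Real.pi, φ t = 0}

/-- The class `C^{α,r}_{β,p}` of generalized Poisson integrals of functions from `B_p^0`. -/
def poissonClass (α r β : ℝ) (p : ℝ≥0∞) : Set (ℝ → ℝ) :=
  {f | ∃ a₀ : ℝ, ∃ φ ∈ unitBallZeroMean p, ∀ x : ℝ,
    f x = a₀ / 2 + 1 / Real.pi * ∫ t in (-Real.pi)..Real.pi, kernel α r β (x - t) * φ t}

/-- The Fourier coefficient `a_k(f) = π⁻¹ ∫_{-π}^{π} f(t) cos (k t) dt`. -/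
def cosCoeff (f : ℝ → ℝ) (k : ℕ) : ℝ :=
  1 / Real.pi * ∫ t in (-Real.pi)..Real.pi, f t * Real.cos (k * t)

/-- The Fourier coefficient `b_k(f) = π⁻¹ ∫_{-π}^{π} f(t) sin (k t) dt`. -/
def sinCoeff (f : ℝ → ℝ) (k : ℕ) : ℝ :=
  1 / Real.pi * ∫ t in (-Real.pi)..Real.pi, f t * Real.sin (k * t)

/-- The partial Fourier sum `S_m(f; x)` of order `m`. -/
def fourierSum (m : ℕ) (f : ℝ → ℝ) (x : ℝ) : ℝ :=
  cosCoeff f 0 / 2 +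
    ∑ k ∈ Finset.Icc 1 m, (cosCoeff f k * Real.cos (k * x) + sinCoeff f k * Real.sin (k * x))

/-- `𝓔_n(C^{α,r}_{β,p})_s = sup ‖f - S_{n-1}(f)‖_s` over `f ∈ C^{α,r}_{β,p}`, for `n ≥ 1`,
as an extended nonnegative number. -/
def fourierDeviation (n : ℕ) (α r β : ℝ) (p s : ℝ≥0∞) : ℝ≥0∞ :=
  ⨆ f ∈ poissonClass α r β p, periodNorm s (fun x => f x - fourierSum (n - 1) f x)

/-- `χ(p) = p` for `p < ∞` and `χ(∞) = 1`. -/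
def chi (p : ℝ≥0∞) : ℝ := if p = ⊤ then 1 else p.toReal

/-- The right-hand side of the inequality that determines `n₀(α, r, p)`. -/
def thresholdBound (p : ℝ≥0∞) : ℝ :=
  if p = 1 then 1 / 14
  else if p = ⊤ then 1 / (3 * Real.pi) ^ 3
  else 1 / (3 * Real.pi) ^ 3 * ((p.toReal - 1) / p.toReal)

/-- The positive integers `n` with
`(α r)⁻¹ n^{-r} + α r χ(p) n^{-(1-r)} ≤ thresholdBound p`. -/
def thresholdSet (α r : ℝ) (p : ℝ≥0∞) : Set ℕ :=
  {n | 1 ≤ n ∧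
    1 / (α * r) * (1 / (n : ℝ) ^ r) + α * r * chi p / (n : ℝ) ^ (1 - r) ≤ thresholdBound p}

/-- `n₀(α, r, p)`, the smallest element of `thresholdSet α r p`. -/
def threshold (α r : ℝ) (p : ℝ≥0∞) : ℕ := sInf (thresholdSet α r p)

theorem thresholdBound_pos {p : ℝ≥0∞} (hp : 1 ≤ p) : 0 < thresholdBound p := by
  unfold thresholdBound
  have hpi := Real.pi_pos
  split_ifs with h1 h2
  · norm_num
  · positivity
  · have h3 : 1 < p.toReal := by
      have h4 : (1 : ℝ≥0∞) < p := lt_of_le_of_ne hp (Ne.symm h1)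
      have := (ENNReal.toReal_lt_toReal ENNReal.one_ne_top h2).2 h4
      simpa using this
    have h5 : 0 < p.toReal - 1 := by linarith
    positivity

/-- The minimum defining `n₀(α, r, p)` is attained. -/
theorem isLeast_threshold {α r : ℝ} (hr0 : 0 < r) (hr1 : r < 1) {p : ℝ≥0∞} (hp : 1 ≤ p) :
    IsLeast (thresholdSet α r p) (threshold α r p) := by
  have hne : (thresholdSet α r p).Nonempty := by
    have hcast := tendsto_natCast_atTop_atTop (R := ℝ)
    have t1 : Filter.Tendsto (fun n : ℕ => 1 / (α * r) * (1 / (n : ℝ) ^ r)) Filter.atTop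
        (nhds (1 / (α * r) * 0)) :=
      (((tendsto_rpow_atTop hr0).comp hcast).const_div_atTop 1).const_mul _
    have t2 : Filter.Tendsto (fun n : ℕ => α * r * chi p / (n : ℝ) ^ (1 - r)) Filter.atTop
        (nhds 0) :=
      ((tendsto_rpow_atTop (sub_pos.2 hr1)).comp hcast).const_div_atTop _
    have t := t1.add t2
    have hlt : 1 / (α * r) * 0 + 0 < thresholdBound p := by
      simpa using thresholdBound_pos hp
    obtain ⟨n, hn, hn1⟩ := ((t.eventually_lt_const hlt).and
      (Filter.eventually_ge_atTop 1)).exists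
    exact ⟨n, hn1, hn.le⟩
  exact ⟨Nat.sInf_mem hne, fun _ hn => Nat.sInf_le hn⟩

end GenPoisson

end

noncomputable section

namespace GenPoisson

open Real MeasureTheory intervalIntegral Filter Topology

/-! By Parseval, the squared deviation of the integral of φ is π ∑_{k ≥ n} e^{-2αk^r} |c_k|² with
|c_k|² = `phaseCos`² + `phaseSin`²; the shift β only rotates the pair c_k. The problem is therefore
how large all the |c_k| can be at once (`fourierDeviation_eq_iSup`).

From above, ‖φ‖₁ ≤ 1 forces |c_k| ≤ 1/π, so the squared supremum is at most π⁻¹ ∑_{k ≥ n} e^{-2αk^r}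
(`fourierDeviation_le`). From below, letting φ approach (δ_0 - δ_h)/2 gives |c_k| → |sin(kh/2)|/π
(`le_fourierDeviation`). For h = π/n the sine is 1 at k = n and stays near 1 on the window of length
about n^{1-r}/(2αr) that carries the bulk of the sum, a window short compared with n.

Put A = 1/(αr n^r) and B = αr/n^{1-r}. The sum equals e^{-2αn^r} n^{1-r}/(2αr) up to relative errors
controlled by A and B: an approximate antiderivative bounds it above (`tsum_decay_succ_le`), a
geometric progression below (`decay_mul_pow_le`). Taking roots puts the deviation between M(1 - A)
and M(1 + B + A), M being the main term (`fourierDeviation_bounds`). -/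

/-! ### Termwise integration and trigonometric orthogonality -/

/-- Termwise integration of a normally convergent series of continuous functions against an
integrable weight. -/
theorem hasSum_integral_tsum_mul {u : ℕ → ℝ → ℝ} {C : ℕ → ℝ} (hu : ∀ k, Continuous (u k))
    (hC : Summable C) (hb : ∀ k x, |u k x| ≤ C k) {w : ℝ → ℝ} {a b : ℝ}
    (hw : IntervalIntegrable w volume a b) :
    HasSum (fun k => ∫ x in a..b, u k x * w x) (∫ x in a..b, (∑' k, u k x) * w x) := by
  have hs : ∀ x, Summable fun k => u k x := fun x =>
    Summable.of_norm_bounded hC fun k => hb k x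
  refine hasSum_integral_of_dominated_convergence (fun k x => C k * |w x|) ?_ ?_ ?_ ?_ ?_
  · intro k
    exact (hu k).aestronglyMeasurable.mul hw.aestronglyMeasurable_restrict_uIoc
  · intro k
    refine ae_of_all _ fun x _ => ?_
    rw [norm_mul]
    exact mul_le_mul_of_nonneg_right (hb k x) (norm_nonneg _)
  · exact ae_of_all _ fun x _ => hC.mul_right _
  · simp_rw [tsum_mul_right]
    exact hw.abs.const_mul _
  · exact ae_of_all _ fun x _ => (hs x).hasSum.mul_right _

theorem integral_cos_int_mul (z : ℤ) :
    ∫ x in (-π)..π, cos (z * x) = if z = 0 then 2 * π else 0 := by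
  split_ifs with h
  · simp [h]; ring
  · have hz : (z : ℝ) ≠ 0 := by exact_mod_cast h
    rw [integral_comp_mul_left (fun x => cos x) hz, integral_cos]
    simp [sin_int_mul_pi]

theorem integral_sin_int_mul (z : ℤ) : ∫ x in (-π)..π, sin (z * x) = 0 := by
  rcases eq_or_ne z 0 with h | h
  · simp [h]
  · have hz : (z : ℝ) ≠ 0 := by exact_mod_cast h
    rw [integral_comp_mul_left (fun x => sin x) hz, integral_sin]
    simp

theorem integral_cos_mul_cos (k m : ℕ) (hk : 1 ≤ k) :
    ∫ x in (-π)..π, cos (k * x) * cos (m * x) = if k = m then π else 0 := by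
  have h : ∀ x : ℝ, cos (k * x) * cos (m * x) =
      (1 / 2) * cos (((k - m : ℤ) : ℝ) * x) + (1 / 2) * cos (((k + m : ℤ) : ℝ) * x) := by
    intro x
    push_cast
    rw [sub_mul, add_mul, cos_sub, cos_add]; ring
  simp_rw [h]
  rw [integral_add (Continuous.intervalIntegrable (by fun_prop) _ _)
    (Continuous.intervalIntegrable (by fun_prop) _ _), intervalIntegral.integral_const_mul,
    intervalIntegral.integral_const_mul, integral_cos_int_mul, integral_cos_int_mul,
    if_neg (by omega : ¬ (k + m : ℤ) = 0)]
  by_cases hkm : k = m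
  · simp [hkm]
  · rw [if_neg (by omega), if_neg hkm]; ring

theorem integral_sin_mul_sin (k m : ℕ) (hk : 1 ≤ k) :
    ∫ x in (-π)..π, sin (k * x) * sin (m * x) = if k = m then π else 0 := by
  have h : ∀ x : ℝ, sin (k * x) * sin (m * x) =
      (1 / 2) * cos (((k - m : ℤ) : ℝ) * x) - (1 / 2) * cos (((k + m : ℤ) : ℝ) * x) := by
    intro x
    push_cast
    rw [sub_mul, add_mul, cos_sub, cos_add]; ring
  simp_rw [h]
  rw [integral_sub (Continuous.intervalIntegrable (by fun_prop) _ _)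
    (Continuous.intervalIntegrable (by fun_prop) _ _), intervalIntegral.integral_const_mul,
    intervalIntegral.integral_const_mul, integral_cos_int_mul, integral_cos_int_mul,
    if_neg (by omega : ¬ (k + m : ℤ) = 0)]
  by_cases hkm : k = m
  · simp [hkm]
  · rw [if_neg (by omega), if_neg hkm]; ring

theorem integral_sin_mul_cos (k m : ℕ) :
    ∫ x in (-π)..π, sin (k * x) * cos (m * x) = 0 := by
  have h : ∀ x : ℝ, sin (k * x) * cos (m * x) =
      (1 / 2) * sin (((k - m : ℤ) : ℝ) * x) + (1 / 2) * sin (((k + m : ℤ) : ℝ) * x) := by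
    intro x
    push_cast
    rw [sub_mul, add_mul, sin_sub, sin_add]; ring
  simp_rw [h]
  rw [integral_add (Continuous.intervalIntegrable (by fun_prop) _ _)
    (Continuous.intervalIntegrable (by fun_prop) _ _), intervalIntegral.integral_const_mul,
    intervalIntegral.integral_const_mul, integral_sin_int_mul, integral_sin_int_mul]
  ring

/-! ### Absolutely convergent trigonometric series and Parseval's identity -/

/-- The `k`-th term of a trigonometric series whose frequencies start at `p`. -/
def trigTerm (p : ℕ) (a b : ℕ → ℝ) (k : ℕ) (x : ℝ) : ℝ :=
  a k * cos ((k + p : ℕ) * x) + b k * sin ((k + p : ℕ) * x)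

/-- The trigonometric series `∑ (a_k cos ((k + p) x) + b_k sin ((k + p) x))`. -/
def trigSeries (p : ℕ) (a b : ℕ → ℝ) (x : ℝ) : ℝ := ∑' k, trigTerm p a b k x

section TrigSeries

variable {p : ℕ} {a b : ℕ → ℝ}

theorem continuous_trigTerm (k : ℕ) : Continuous (trigTerm p a b k) := by
  unfold trigTerm; fun_prop

theorem abs_trigTerm_le (k : ℕ) (x : ℝ) : |trigTerm p a b k x| ≤ |a k| + |b k| := by
  unfold trigTerm
  refine (abs_add_le _ _).trans (add_le_add ?_ ?_) <;> rw [abs_mul]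
  · exact mul_le_of_le_one_right (abs_nonneg _) (abs_cos_le_one _)
  · exact mul_le_of_le_one_right (abs_nonneg _) (abs_sin_le_one _)

theorem summable_trigTerm (ha : Summable fun k => |a k|) (hb : Summable fun k => |b k|) (x : ℝ) :
    Summable fun k => trigTerm p a b k x :=
  Summable.of_norm_bounded (ha.add hb) fun k => abs_trigTerm_le k x

theorem continuous_trigSeries (ha : Summable fun k => |a k|) (hb : Summable fun k => |b k|) :
    Continuous (trigSeries p a b) :=
  continuous_tsum continuous_trigTerm (ha.add hb) fun k x => abs_trigTerm_le k x

theorem periodic_trigSeries : Function.Periodic (trigSeries p a b) (2 * π) := by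
  intro x
  unfold trigSeries trigTerm
  congr 1
  ext k
  rw [mul_add, cos_add_nat_mul_two_pi, sin_add_nat_mul_two_pi]

theorem integral_trigTerm_mul_cos (hp : 1 ≤ p) (k m : ℕ) :
    ∫ x in (-π)..π, trigTerm p a b k x * cos (m * x) = if k + p = m then π * a k else 0 := by
  have h : ∀ x, trigTerm p a b k x * cos (m * x) =
      a k * (cos ((k + p : ℕ) * x) * cos (m * x)) + b k * (sin ((k + p : ℕ) * x) * cos (m * x)) :=
    fun x => by unfold trigTerm; ring
  simp_rw [h]
  rw [integral_add (Continuous.intervalIntegrable (by fun_prop) _ _)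
    (Continuous.intervalIntegrable (by fun_prop) _ _), intervalIntegral.integral_const_mul,
    intervalIntegral.integral_const_mul, integral_cos_mul_cos _ _ (by omega), integral_sin_mul_cos]
  split_ifs <;> ring

theorem integral_trigTerm_mul_sin (hp : 1 ≤ p) (k m : ℕ) :
    ∫ x in (-π)..π, trigTerm p a b k x * sin (m * x) = if k + p = m then π * b k else 0 := by
  have h : ∀ x, trigTerm p a b k x * sin (m * x) =
      a k * (sin (m * x) * cos ((k + p : ℕ) * x)) + b k * (sin ((k + p : ℕ) * x) * sin (m * x)) :=
    fun x => by unfold trigTerm; ring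
  simp_rw [h]
  rw [integral_add (Continuous.intervalIntegrable (by fun_prop) _ _)
    (Continuous.intervalIntegrable (by fun_prop) _ _), intervalIntegral.integral_const_mul,
    intervalIntegral.integral_const_mul, integral_sin_mul_sin _ _ (by omega), integral_sin_mul_cos]
  split_ifs <;> ring

theorem hasSum_integral_trigSeries_mul (ha : Summable fun k => |a k|)
    (hb : Summable fun k => |b k|) {w : ℝ → ℝ} (hw : Continuous w) :
    HasSum (fun k => ∫ x in (-π)..π, trigTerm p a b k x * w x)
      (∫ x in (-π)..π, trigSeries p a b x * w x) :=
  hasSum_integral_tsum_mul continuous_trigTerm (ha.add hb) abs_trigTerm_le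
    (hw.intervalIntegrable _ _)

theorem integral_trigSeries_mul_cos (hp : 1 ≤ p) (ha : Summable fun k => |a k|)
    (hb : Summable fun k => |b k|) (q : ℕ) :
    ∫ x in (-π)..π, trigSeries p a b x * cos ((q + p : ℕ) * x) = π * a q := by
  have h := hasSum_integral_trigSeries_mul (p := p) ha hb
    (w := fun x => cos ((q + p : ℕ) * x)) (by fun_prop)
  simp_rw [integral_trigTerm_mul_cos hp] at h
  refine h.unique ?_
  convert hasSum_ite_eq q (π * a q) using 2 with k
  by_cases hk : k = q <;> simp [hk]

theorem integral_trigSeries_mul_sin (hp : 1 ≤ p) (ha : Summable fun k => |a k|)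
    (hb : Summable fun k => |b k|) (q : ℕ) :
    ∫ x in (-π)..π, trigSeries p a b x * sin ((q + p : ℕ) * x) = π * b q := by
  have h := hasSum_integral_trigSeries_mul (p := p) ha hb
    (w := fun x => sin ((q + p : ℕ) * x)) (by fun_prop)
  simp_rw [integral_trigTerm_mul_sin hp] at h
  refine h.unique ?_
  convert hasSum_ite_eq q (π * b q) using 2 with k
  by_cases hk : k = q <;> simp [hk]

theorem integral_trigSeries (hp : 1 ≤ p) (ha : Summable fun k => |a k|)
    (hb : Summable fun k => |b k|) : ∫ x in (-π)..π, trigSeries p a b x = 0 := by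
  -- The weight 1 is written as cos(0·x), so that cosine orthogonality applies; no frequency k + p
  -- vanishes.
  have h := hasSum_integral_trigSeries_mul (p := p) ha hb
    (w := fun x => cos ((0 : ℕ) * x)) (by fun_prop)
  have h0 : ∀ k, ¬ k + p = 0 := fun k => by omega
  simp_rw [integral_trigTerm_mul_cos hp, h0, if_false] at h
  simpa using h.unique hasSum_zero

/-- Parseval's identity for absolutely convergent trigonometric series. -/
theorem hasSum_integral_trigSeries_sq (hp : 1 ≤ p) (ha : Summable fun k => |a k|)
    (hb : Summable fun k => |b k|) :
    HasSum (fun k => π * (a k ^ 2 + b k ^ 2)) (∫ x in (-π)..π, trigSeries p a b x ^ 2) := by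
  have hc := continuous_trigSeries (p := p) ha hb
  -- The series itself is the weight: one factor is expanded, and the other then contributes its
  -- Fourier coefficients.
  have h := hasSum_integral_trigSeries_mul (p := p) ha hb hc
  simp_rw [← pow_two] at h
  convert h using 2 with k
  have h1 : ∀ x, trigTerm p a b k x * trigSeries p a b x =
      a k * (trigSeries p a b x * cos ((k + p : ℕ) * x)) +
        b k * (trigSeries p a b x * sin ((k + p : ℕ) * x)) := fun x => by unfold trigTerm; ring
  simp_rw [h1]
  rw [integral_add (Continuous.intervalIntegrable (by fun_prop) _ _)
    (Continuous.intervalIntegrable (by fun_prop) _ _), intervalIntegral.integral_const_mul,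
    intervalIntegral.integral_const_mul, integral_trigSeries_mul_cos hp ha hb,
    integral_trigSeries_mul_sin hp ha hb]
  ring

theorem periodNorm_trigSeries (hp : 1 ≤ p) (ha : Summable fun k => |a k|)
    (hb : Summable fun k => |b k|) :
    periodNorm 2 (trigSeries p a b) = ENNReal.ofReal √(π * ∑' k, (a k ^ 2 + b k ^ 2)) := by
  have hc := continuous_trigSeries (p := p) ha hb
  have hm : MemLp (trigSeries p a b) 2 periodMeasure := by
    refine (memLp_two_iff_integrable_sq hc.aestronglyMeasurable).2 ?_
    exact ((hc.pow 2).integrableOn_Icc (a := 0) (b := 2 * π)).mono_set Set.Ico_subset_Icc_self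
  have hi : ∫ x, ‖trigSeries p a b x‖ ^ (2 : ℝ) ∂periodMeasure =
      π * ∑' k, (a k ^ 2 + b k ^ 2) := by
    rw [← tsum_mul_left, (hasSum_integral_trigSeries_sq hp ha hb).tsum_eq]
    -- The norm lives on [0, 2π), the coefficients on [-π, π]; periodicity moves between them.
    have h2 := (periodic_trigSeries (p := p) (a := a) (b := b)).comp (fun y => y ^ 2)
    have h3 := h2.intervalIntegral_add_eq 0 (-π)
    rw [zero_add, show -π + 2 * π = π by ring] at h3
    refine Eq.trans ?_ h3
    rw [intervalIntegral.integral_of_le (by positivity), ← integral_Ico_eq_integral_Ioc]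
    simp [periodMeasure]
  rw [periodNorm, hm.eLpNorm_eq_integral_rpow_norm (by norm_num) (by norm_num)]
  simp only [ENNReal.toReal_ofNat]
  rw [hi, sqrt_eq_rpow]
  norm_num

end TrigSeries

/-! ### Fourier expansion of generalized Poisson integrals -/

/-- The coefficients `e^{-α k^r}` of the generalized Poisson kernel. -/
def decay (α r : ℝ) (k : ℕ) : ℝ := exp (-α * (k : ℝ) ^ r)

theorem decay_pos (α r : ℝ) (k : ℕ) : 0 < decay α r k := exp_pos _

theorem decay_sq (α r : ℝ) (k : ℕ) : decay α r k ^ 2 = exp (-(2 * α) * (k : ℝ) ^ r) := by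
  rw [decay, ← exp_nat_mul]; congr 1; push_cast; ring

/-- Since e^{-αy} = o(y^{-2/r}), substituting y = k^r gives O(k^{-2}). -/
theorem summable_decay {α r : ℝ} (hα : 0 < α) (hr : 0 < r) : Summable (decay α r) := by
  have h1 := (isLittleO_exp_neg_mul_rpow_atTop hα (-2 / r)).comp_tendsto
    ((tendsto_rpow_atTop hr).comp (tendsto_natCast_atTop_atTop (R := ℝ)))
  have h2 : Summable fun k : ℕ => (k : ℝ) ^ (-2 : ℝ) :=
    Real.summable_nat_rpow.2 (by norm_num)
  refine summable_of_isBigO_nat h2 (h1.isBigO.congr (fun _ => rfl) fun k => ?_)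
  simp only [Function.comp]
  rw [← rpow_mul (Nat.cast_nonneg k)]
  congr 1
  field_simp

theorem summable_decay_add {α r : ℝ} (hα : 0 < α) (hr : 0 < r) (p : ℕ) :
    Summable fun k => decay α r (k + p) :=
  (summable_nat_add_iff p).2 (summable_decay hα hr)

/-- The coefficient `π⁻¹ ∫ cos (k t + β π / 2) φ(t) dt`. -/
def phaseCos (β : ℝ) (φ : ℝ → ℝ) (k : ℕ) : ℝ :=
  1 / π * ∫ t in (-π)..π, cos (k * t + β * π / 2) * φ t

/-- The coefficient `π⁻¹ ∫ sin (k t + β π / 2) φ(t) dt`. -/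
def phaseSin (β : ℝ) (φ : ℝ → ℝ) (k : ℕ) : ℝ :=
  1 / π * ∫ t in (-π)..π, sin (k * t + β * π / 2) * φ t

/-- The part of a generalized Poisson integral of `φ` with frequencies at least `p`. -/
def poissonTail (α r β : ℝ) (φ : ℝ → ℝ) (p : ℕ) : ℝ → ℝ :=
  trigSeries p (fun k => decay α r (k + p) * phaseCos β φ (k + p))
    (fun k => decay α r (k + p) * phaseSin β φ (k + p))

section Integrable

variable {β : ℝ} {φ : ℝ → ℝ} (hφ : IntervalIntegrable φ volume (-π) π)

include hφ

/-- With R² = A² + B², Cauchy–Schwarz gives |A cos + B sin| ≤ R, so πR² = ∫ (A cos + B sin) φ ≤ R ∫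
|φ| ≤ R. Testing both coefficients together avoids the factor 2 lost by bounding them separately. -/
theorem phaseCos_sq_add_phaseSin_sq_le (h1 : ∫ t in (-π)..π, |φ t| ≤ 1) (k : ℕ) :
    phaseCos β φ k ^ 2 + phaseSin β φ k ^ 2 ≤ 1 / π ^ 2 := by
  set A := phaseCos β φ k with hA
  set B := phaseSin β φ k with hB
  set R := √(A ^ 2 + B ^ 2) with hR
  have hR2 : R ^ 2 = A ^ 2 + B ^ 2 := sq_sqrt (by positivity)
  have hi1 : IntervalIntegrable (fun t => cos (k * t + β * π / 2) * φ t) volume (-π) π :=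
    hφ.continuousOn_mul (by fun_prop)
  have hi2 : IntervalIntegrable (fun t => sin (k * t + β * π / 2) * φ t) volume (-π) π :=
    hφ.continuousOn_mul (by fun_prop)
  have hpt : ∀ t, A * (cos (k * t + β * π / 2) * φ t) + B * (sin (k * t + β * π / 2) * φ t) ≤
      R * |φ t| := by
    intro t
    set c := cos (k * t + β * π / 2)
    set s := sin (k * t + β * π / 2)
    have hcs : s ^ 2 + c ^ 2 = 1 := sin_sq_add_cos_sq _
    have h2 : |A * c + B * s| ≤ R := by
      apply abs_le_of_sq_le_sq _ (sqrt_nonneg _)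
      rw [hR2]
      nlinarith [sq_nonneg (A * s - B * c)]
    calc A * (c * φ t) + B * (s * φ t) = (A * c + B * s) * φ t := by ring
      _ ≤ |(A * c + B * s) * φ t| := le_abs_self _
      _ = |A * c + B * s| * |φ t| := abs_mul _ _
      _ ≤ R * |φ t| := mul_le_mul_of_nonneg_right h2 (abs_nonneg _)
  have h3 := integral_mono_on (by linarith [pi_pos] : -π ≤ π)
    ((hi1.const_mul A).add (hi2.const_mul B)) (hφ.abs.const_mul R) fun t _ => hpt t
  rw [integral_add (hi1.const_mul A) (hi2.const_mul B), intervalIntegral.integral_const_mul,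
    intervalIntegral.integral_const_mul, intervalIntegral.integral_const_mul] at h3
  have e1 : ∫ t in (-π)..π, cos (k * t + β * π / 2) * φ t = π * A := by
    rw [hA, phaseCos, ← mul_assoc, mul_one_div_cancel pi_ne_zero, one_mul]
  have e2 : ∫ t in (-π)..π, sin (k * t + β * π / 2) * φ t = π * B := by
    rw [hB, phaseSin, ← mul_assoc, mul_one_div_cancel pi_ne_zero, one_mul]
  rw [e1, e2] at h3
  have h4 : R * ∫ t in (-π)..π, |φ t| ≤ R * 1 :=
    mul_le_mul_of_nonneg_left h1 (sqrt_nonneg _)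
  have h5 : π * R ^ 2 ≤ R := by rw [hR2]; linarith
  have h6 : π * R ≤ 1 := by
    rcases (sqrt_nonneg (A ^ 2 + B ^ 2)).eq_or_lt with h | h
    · rw [← hR] at h; rw [← h]; norm_num
    · exact le_of_mul_le_mul_right (by rw [← hR] at *; linarith) h
  rw [← hR2, le_div_iff₀ (by positivity), mul_comm, ← mul_pow]
  exact pow_le_one₀ (by positivity) h6

theorem abs_phaseCos_le (h1 : ∫ t in (-π)..π, |φ t| ≤ 1) (k : ℕ) : |phaseCos β φ k| ≤ 1 / π := by
  refine abs_le_of_sq_le_sq ?_ (by positivity)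
  have := phaseCos_sq_add_phaseSin_sq_le (β := β) hφ h1 k
  rw [div_pow, one_pow]
  linarith [sq_nonneg (phaseSin β φ k)]

theorem abs_phaseSin_le (h1 : ∫ t in (-π)..π, |φ t| ≤ 1) (k : ℕ) : |phaseSin β φ k| ≤ 1 / π := by
  refine abs_le_of_sq_le_sq ?_ (by positivity)
  have := phaseCos_sq_add_phaseSin_sq_le (β := β) hφ h1 k
  rw [div_pow, one_pow]
  linarith [sq_nonneg (phaseCos β φ k)]

theorem summable_decay_mul_phaseCos {α r : ℝ} (hα : 0 < α) (hr : 0 < r)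
    (h1 : ∫ t in (-π)..π, |φ t| ≤ 1) (p : ℕ) :
    Summable fun k => |decay α r (k + p) * phaseCos β φ (k + p)| := by
  refine Summable.of_nonneg_of_le (fun _ => abs_nonneg _) (fun k => ?_)
    ((summable_decay_add hα hr p).mul_right (1 / π))
  rw [abs_mul, abs_of_pos (decay_pos _ _ _)]
  exact mul_le_mul_of_nonneg_left (abs_phaseCos_le hφ h1 _) (decay_pos _ _ _).le

theorem summable_decay_mul_phaseSin {α r : ℝ} (hα : 0 < α) (hr : 0 < r)
    (h1 : ∫ t in (-π)..π, |φ t| ≤ 1) (p : ℕ) :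
    Summable fun k => |decay α r (k + p) * phaseSin β φ (k + p)| := by
  refine Summable.of_nonneg_of_le (fun _ => abs_nonneg _) (fun k => ?_)
    ((summable_decay_add hα hr p).mul_right (1 / π))
  rw [abs_mul, abs_of_pos (decay_pos _ _ _)]
  exact mul_le_mul_of_nonneg_left (abs_phaseSin_le hφ h1 _) (decay_pos _ _ _).le

/-- Writing k(x - t) - βπ/2 = kx - (kt + βπ/2) moves the shift β from the kernel into the
coefficients of φ. -/
theorem integral_kernel_mul {α r : ℝ} (hα : 0 < α) (hr : 0 < r) (x : ℝ) :
    1 / π * ∫ t in (-π)..π, kernel α r β (x - t) * φ t = poissonTail α r β φ 1 x := by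
  have h := hasSum_integral_tsum_mul
    (u := fun k t => decay α r (k + 1) * cos (((k + 1 : ℕ) : ℝ) * (x - t) - β * π / 2))
    (fun k => by fun_prop) (summable_decay_add hα hr 1)
    (fun k t => by
      rw [abs_mul, abs_of_pos (decay_pos _ _ _)]
      exact mul_le_of_le_one_right (decay_pos _ _ _).le (abs_cos_le_one _)) hφ
  have h2 : ∫ t in (-π)..π, kernel α r β (x - t) * φ t = ∑' k : ℕ, ∫ t in (-π)..π,
      decay α r (k + 1) * cos (((k + 1 : ℕ) : ℝ) * (x - t) - β * π / 2) * φ t := h.tsum_eq.symm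
  rw [h2, ← tsum_mul_left, poissonTail, trigSeries]
  congr 1
  ext k
  have hi1 : IntervalIntegrable (fun t => cos ((k + 1 : ℕ) * t + β * π / 2) * φ t)
      volume (-π) π := hφ.continuousOn_mul (by fun_prop)
  have hi2 : IntervalIntegrable (fun t => sin ((k + 1 : ℕ) * t + β * π / 2) * φ t)
      volume (-π) π := hφ.continuousOn_mul (by fun_prop)
  have h3 : ∀ t, decay α r (k + 1) * cos (((k + 1 : ℕ) : ℝ) * (x - t) - β * π / 2) * φ t =
      decay α r (k + 1) * cos ((k + 1 : ℕ) * x) * (cos ((k + 1 : ℕ) * t + β * π / 2) * φ t) +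
      decay α r (k + 1) * sin ((k + 1 : ℕ) * x) * (sin ((k + 1 : ℕ) * t + β * π / 2) * φ t) := by
    intro t
    rw [show ((k + 1 : ℕ) : ℝ) * (x - t) - β * π / 2 =
      (k + 1 : ℕ) * x - ((k + 1 : ℕ) * t + β * π / 2) by ring, cos_sub]
    ring
  simp_rw [h3]
  rw [integral_add (hi1.const_mul _) (hi2.const_mul _), intervalIntegral.integral_const_mul,
    intervalIntegral.integral_const_mul, trigTerm, phaseCos, phaseSin]
  ring

end Integrable

/-- By orthogonality the series is its own Fourier series, so S_m removes the constant and m terms.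
Index k carries frequency k + 1, hence the remainder starts at frequency m + 1. -/
theorem const_add_trigSeries_sub_fourierSum {a b : ℕ → ℝ} (ha : Summable fun k => |a k|)
    (hb : Summable fun k => |b k|) {f : ℝ → ℝ} {a₀ : ℝ}
    (hf : ∀ x, f x = a₀ / 2 + trigSeries 1 a b x) (m : ℕ) (x : ℝ) :
    f x - fourierSum m f x =
      trigSeries (m + 1) (fun k => a (k + m)) (fun k => b (k + m)) x := by
  have hc := continuous_trigSeries (p := 1) ha hb
  have h0 : cosCoeff f 0 = a₀ := by
    have : ∫ t in (-π)..π, f t * cos ((0 : ℕ) * t) = π * a₀ := by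
      simp only [Nat.cast_zero, zero_mul, cos_zero, mul_one, hf]
      rw [integral_add (by simp) (hc.intervalIntegrable _ _),
        integral_trigSeries le_rfl ha hb, intervalIntegral.integral_const, smul_eq_mul]
      ring
    rw [cosCoeff, this]
    field_simp
  have hcos : ∀ k, cosCoeff f (k + 1) = a k := by
    intro k
    have h1 := integral_cos_int_mul ((k : ℤ) + 1)
    rw [if_neg (by omega)] at h1
    push_cast at h1
    have : ∫ t in (-π)..π, f t * cos ((k + 1 : ℕ) * t) = π * a k := by
      simp only [hf, add_mul (a₀ / 2)]
      rw [integral_add (Continuous.intervalIntegrable (by fun_prop) _ _)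
        (Continuous.intervalIntegrable (by fun_prop) _ _),
        integral_trigSeries_mul_cos le_rfl ha hb, intervalIntegral.integral_const_mul]
      push_cast
      rw [h1]; ring
    rw [cosCoeff, this]
    field_simp
  have hsin : ∀ k, sinCoeff f (k + 1) = b k := by
    intro k
    have h1 := integral_sin_int_mul ((k : ℤ) + 1)
    push_cast at h1
    have : ∫ t in (-π)..π, f t * sin ((k + 1 : ℕ) * t) = π * b k := by
      simp only [hf, add_mul (a₀ / 2)]
      rw [integral_add (Continuous.intervalIntegrable (by fun_prop) _ _)
        (Continuous.intervalIntegrable (by fun_prop) _ _),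
        integral_trigSeries_mul_sin le_rfl ha hb, intervalIntegral.integral_const_mul]
      push_cast
      rw [h1]; ring
    rw [sinCoeff, this]
    field_simp
  have hsum : ∑ k ∈ Finset.Icc 1 m, (cosCoeff f k * cos (k * x) + sinCoeff f k * sin (k * x)) =
      ∑ k ∈ Finset.range m, trigTerm 1 a b k x := by
    rw [← Finset.Ico_add_one_right_eq_Icc, Finset.sum_Ico_eq_sum_range]
    refine Finset.sum_congr rfl fun k _ => ?_
    rw [add_comm 1 k, hcos, hsin, trigTerm]
  have hsplit := (summable_trigTerm (p := 1) ha hb x).sum_add_tsum_nat_add m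
  rw [hf, fourierSum, h0, hsum, trigSeries, ← hsplit, trigSeries]
  have : ∀ k, trigTerm 1 a b (k + m) x =
      trigTerm (m + 1) (fun k => a (k + m)) (fun k => b (k + m)) k x := fun k => by
    simp only [trigTerm, add_assoc]
  simp_rw [this]
  ring

/-! ### The unit ball of L₁ and reduction to a coefficient functional -/

section UnitBall

variable {φ : ℝ → ℝ}

theorem intervalIntegrable_of_mem_unitBall (h : φ ∈ unitBallZeroMean 1) :
    IntervalIntegrable φ volume (-π) π := by
  obtain ⟨hp, hm, -, -⟩ := h
  refine hp.intervalIntegrable₀ (by positivity) ?_ _ _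
  rw [intervalIntegrable_iff_integrableOn_Ico_of_le (by positivity)]
  exact memLp_one_iff_integrable.1 hm

theorem integral_periodMeasure {g : ℝ → ℝ} (hg : Function.Periodic g (2 * π)) :
    ∫ x, g x ∂periodMeasure = ∫ x in (-π)..π, g x := by
  have h := hg.intervalIntegral_add_eq 0 (-π)
  rw [zero_add, show -π + 2 * π = π by ring] at h
  rw [← h, intervalIntegral.integral_of_le (by positivity), ← integral_Ico_eq_integral_Ioc,
    periodMeasure]

theorem integral_abs_le_of_mem_unitBall (h : φ ∈ unitBallZeroMean 1) :
    ∫ t in (-π)..π, |φ t| ≤ 1 := by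
  obtain ⟨hp, hm, hn, -⟩ := h
  have h := integral_periodMeasure (hp.comp abs)
  rw [Function.comp_def] at h
  rw [← h]
  have := integral_norm_eq_lintegral_enorm hm.1
  rw [← eLpNorm_one_eq_lintegral_enorm] at this
  simp only [Real.norm_eq_abs] at this
  rw [this]
  exact ENNReal.toReal_le_of_le_ofReal zero_le_one (by simpa [periodNorm] using hn)

theorem mem_unitBall_of_continuous (hc : Continuous φ) (hp : Function.Periodic φ (2 * π))
    (h1 : ∫ t in (-π)..π, |φ t| ≤ 1) (h0 : ∫ t in (-π)..π, φ t = 0) :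
    φ ∈ unitBallZeroMean 1 := by
  have hi : Integrable φ periodMeasure :=
    (hc.integrableOn_Icc (a := 0) (b := 2 * π)).mono_set Set.Ico_subset_Icc_self
  refine ⟨hp, memLp_one_iff_integrable.2 hi, ?_, h0⟩
  rw [periodNorm, eLpNorm_one_eq_lintegral_enorm, ← ofReal_integral_norm_eq_lintegral_enorm hi]
  simp only [Real.norm_eq_abs]
  have := integral_periodMeasure (hp.comp abs)
  rw [Function.comp_def] at this
  rw [this]
  exact ENNReal.ofReal_le_one.2 h1

end UnitBall

/-- The value of the deviation functional at the generalized Poisson integral of `φ`. -/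
def tailNorm (α r β : ℝ) (φ : ℝ → ℝ) (n : ℕ) : ℝ :=
  √(π * ∑' k, decay α r (k + n) ^ 2 *
    (phaseCos β φ (k + n) ^ 2 + phaseSin β φ (k + n) ^ 2))

theorem periodNorm_sub_fourierSum {α r β a₀ : ℝ} (hα : 0 < α) (hr : 0 < r) {φ f : ℝ → ℝ}
    (hφ : φ ∈ unitBallZeroMean 1)
    (hf : ∀ x, f x = a₀ / 2 + 1 / π * ∫ t in (-π)..π, kernel α r β (x - t) * φ t)
    {n : ℕ} (hn : 1 ≤ n) :
    periodNorm 2 (fun x => f x - fourierSum (n - 1) f x) =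
      ENNReal.ofReal (tailNorm α r β φ n) := by
  obtain ⟨m, rfl⟩ : ∃ m, n = m + 1 := ⟨n - 1, by omega⟩
  have hi := intervalIntegrable_of_mem_unitBall hφ
  have h1 := integral_abs_le_of_mem_unitBall hφ
  have hf' : ∀ x, f x = a₀ / 2 + poissonTail α r β φ 1 x := fun x => by
    rw [hf, integral_kernel_mul hi hα hr]
  have h2 : (fun x => f x - fourierSum (m + 1 - 1) f x) = poissonTail α r β φ (m + 1) := by
    ext x
    rw [Nat.add_sub_cancel, const_add_trigSeries_sub_fourierSum
      (summable_decay_mul_phaseCos hi hα hr h1 1)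
      (summable_decay_mul_phaseSin hi hα hr h1 1) hf', poissonTail]
    simp only [add_assoc]
  rw [h2, poissonTail, periodNorm_trigSeries (by omega)
    (summable_decay_mul_phaseCos hi hα hr h1 _) (summable_decay_mul_phaseSin hi hα hr h1 _),
    tailNorm]
  simp only [mul_pow, mul_add]

/-- The constant a₀ cancels in f - S_{n-1}(f), so only φ matters; a₀ = 0 represents each φ. -/
theorem fourierDeviation_eq_iSup {α r β : ℝ} (hα : 0 < α) (hr : 0 < r) {n : ℕ} (hn : 1 ≤ n) :
    fourierDeviation n α r β 1 2 =
      ⨆ φ ∈ unitBallZeroMean 1, ENNReal.ofReal (tailNorm α r β φ n) := by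
  apply le_antisymm
  · refine iSup₂_le fun f hf => ?_
    obtain ⟨a₀, φ, hφ, hf⟩ := hf
    rw [periodNorm_sub_fourierSum hα hr hφ hf hn]
    exact le_iSup₂_of_le φ hφ le_rfl
  · refine iSup₂_le fun φ hφ => ?_
    have hf : ∀ x, (fun x => (0 : ℝ) / 2 + 1 / π * ∫ t in (-π)..π, kernel α r β (x - t) * φ t) x =
      (0 : ℝ) / 2 + 1 / π * ∫ t in (-π)..π, kernel α r β (x - t) * φ t := fun _ => rfl
    rw [← periodNorm_sub_fourierSum hα hr hφ hf hn]
    exact le_iSup₂_of_le (f := fun f (_ : f ∈ poissonClass α r β 1) =>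
      periodNorm 2 (fun x => f x - fourierSum (n - 1) f x)) _ ⟨0, φ, hφ, hf⟩ le_rfl

theorem summable_decay_sq {α r : ℝ} (hα : 0 < α) (hr : 0 < r) (n : ℕ) :
    Summable fun k => decay α r (k + n) ^ 2 := by
  simp_rw [decay_sq]
  exact summable_decay_add (by positivity : 0 < 2 * α) hr n

theorem fourierDeviation_le {α r β : ℝ} (hα : 0 < α) (hr : 0 < r) {n : ℕ} (hn : 1 ≤ n) :
    fourierDeviation n α r β 1 2 ≤
      ENNReal.ofReal √(1 / π * ∑' k, decay α r (k + n) ^ 2) := by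
  rw [fourierDeviation_eq_iSup hα hr hn]
  refine iSup₂_le fun φ hφ => ENNReal.ofReal_le_ofReal (sqrt_le_sqrt ?_)
  have hi := intervalIntegrable_of_mem_unitBall hφ
  have h1 := integral_abs_le_of_mem_unitBall hφ
  have hle : ∀ k, decay α r (k + n) ^ 2 *
      (phaseCos β φ (k + n) ^ 2 + phaseSin β φ (k + n) ^ 2) ≤
      decay α r (k + n) ^ 2 * (1 / π ^ 2) := fun k =>
    mul_le_mul_of_nonneg_left (phaseCos_sq_add_phaseSin_sq_le hi h1 _) (sq_nonneg _)
  have hs := (summable_decay_sq hα hr n).mul_right (1 / π ^ 2)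
  have h2 := (Summable.of_nonneg_of_le (fun k => by positivity) hle hs).tsum_le_tsum hle hs
  rw [tsum_mul_right] at h2
  calc _ ≤ π * ((∑' k, decay α r (k + n) ^ 2) * (1 / π ^ 2)) :=
        mul_le_mul_of_nonneg_left h2 pi_pos.le
    _ = _ := by field_simp

/-! ### Near-extremal functions and the lower bound -/

/-- A nonnegative `2π`-periodic function peaking at `0`. -/
def peak (m : ℕ) (t : ℝ) : ℝ := ((1 + cos t) / 2) ^ m

/-- The mass of `peak m` over a period. -/
def peakMass (m : ℕ) : ℝ := ∫ t in (-π)..π, peak m t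

/-- An approximation of half the difference of the unit masses at `0` and `h`. -/
def dipole (h : ℝ) (m : ℕ) (t : ℝ) : ℝ := (2 * peakMass m)⁻¹ * (peak m t - peak m (t - h))

theorem continuous_peak (m : ℕ) : Continuous (peak m) := by unfold peak; fun_prop

theorem periodic_peak (m : ℕ) : Function.Periodic (peak m) (2 * π) := fun t => by
  simp [peak]

theorem peak_nonneg (m : ℕ) (t : ℝ) : 0 ≤ peak m t :=
  pow_nonneg (by linarith [neg_one_le_cos t]) _

theorem peakMass_pos (m : ℕ) : 0 < peakMass m := by
  refine intervalIntegral_pos_of_pos_on ((continuous_peak m).intervalIntegrable _ _) ?_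
    (by linarith [pi_pos])
  intro t ht
  have : cos t ≠ -1 := by
    intro h
    have h2 : cos (t / 2) = 0 := by
      have := cos_sq (t / 2)
      rw [mul_div_cancel₀ t two_ne_zero, h] at this
      exact pow_eq_zero_iff two_ne_zero |>.1 (by linarith)
    exact (cos_pos_of_mem_Ioo ⟨by linarith [ht.1], by linarith [ht.2]⟩).ne' h2
  exact pow_pos (by linarith [lt_of_le_of_ne (neg_one_le_cos t) this.symm]) _

theorem continuous_dipole (h : ℝ) (m : ℕ) : Continuous (dipole h m) := by
  have := continuous_peak m
  unfold dipole; fun_prop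

theorem periodic_dipole (h : ℝ) (m : ℕ) : Function.Periodic (dipole h m) (2 * π) := fun t => by
  rw [dipole, dipole, periodic_peak m t, show t + 2 * π - h = t - h + 2 * π by ring,
    periodic_peak m]

theorem integral_comp_sub_of_periodic {g : ℝ → ℝ} (hg : Function.Periodic g (2 * π)) (h : ℝ) :
    ∫ t in (-π)..π, g (t - h) = ∫ t in (-π)..π, g t := by
  rw [integral_comp_sub_right g h]
  have := hg.intervalIntegral_add_eq (-π - h) (-π)
  rw [show -π - h + 2 * π = π - h by ring, show -π + 2 * π = π by ring] at this
  exact this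

/-- The two bumps have equal mass, so the mean vanishes; the triangle inequality and the factor 1/2
keep the norm at most 1. -/
theorem dipole_mem_unitBall (h : ℝ) (m : ℕ) : dipole h m ∈ unitBallZeroMean 1 := by
  have hM := peakMass_pos m
  have hc := continuous_peak m
  have hs : ∫ t in (-π)..π, peak m (t - h) = peakMass m :=
    integral_comp_sub_of_periodic (periodic_peak m) h
  refine mem_unitBall_of_continuous (continuous_dipole h m) (periodic_dipole h m) ?_ ?_
  · have hle : ∫ t in (-π)..π, |dipole h m t| ≤
        ∫ t in (-π)..π, (2 * peakMass m)⁻¹ * (peak m t + peak m (t - h)) := by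
      refine integral_mono_on (by linarith [pi_pos])
        ((continuous_dipole h m).abs.intervalIntegrable _ _)
        (Continuous.intervalIntegrable (by fun_prop) _ _) fun t _ => ?_
      rw [dipole, abs_mul, abs_of_pos (by positivity : 0 < (2 * peakMass m)⁻¹)]
      refine mul_le_mul_of_nonneg_left ?_ (by positivity)
      rw [abs_le]
      constructor <;> linarith [peak_nonneg m t, peak_nonneg m (t - h)]
    refine hle.trans_eq ?_
    rw [intervalIntegral.integral_const_mul, integral_add (hc.intervalIntegrable _ _)
      (Continuous.intervalIntegrable (by fun_prop) _ _), hs, ← peakMass]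
    field_simp
    norm_num
  · simp only [dipole]
    rw [intervalIntegral.integral_const_mul, integral_sub (hc.intervalIntegrable _ _)
      (Continuous.intervalIntegrable (by fun_prop) _ _), hs, ← peakMass, sub_self, mul_zero]

/-- On [-π, π] the function (1 + cos t)/2 has its unique maximum at 0, so its normalized powers form
an approximate identity. -/
theorem tendsto_integral_peak_mul {g : ℝ → ℝ} (hg : Continuous g) :
    Tendsto (fun m => (peakMass m)⁻¹ * ∫ t in (-π)..π, peak m t * g t) atTop (𝓝 (g 0)) := by
  have hπ := pi_pos
  have h := tendsto_setIntegral_pow_smul_of_unique_maximum_of_isCompact_of_continuousOn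
    (μ := volume) (s := Set.Icc (-π) π) (c := fun t => (1 + cos t) / 2) (g := g) (x₀ := 0)
    isCompact_Icc (by fun_prop) ?_ ?_ (by simp) ?_ hg.continuousOn
  · convert h using 2 with m
    rw [peakMass, intervalIntegral.integral_of_le (by linarith),
      intervalIntegral.integral_of_le (by linarith), ← integral_Icc_eq_integral_Ioc,
      ← integral_Icc_eq_integral_Ioc]
    rfl
  · intro y hy hy0
    have : cos y < 1 := by
      refine lt_of_le_of_ne (cos_le_one y) fun h => hy0 ?_
      exact (cos_eq_one_iff_of_lt_of_lt (by linarith [hy.1]) (by linarith [hy.2])).1 h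
    simp only [cos_zero]; linarith
  · intro y _
    show 0 ≤ (1 + cos y) / 2
    linarith [neg_one_le_cos y]
  · rw [interior_Icc]
    exact subset_closure ⟨by linarith, hπ⟩

theorem tendsto_integral_mul_dipole {g : ℝ → ℝ} (hg : Continuous g)
    (hp : Function.Periodic g (2 * π)) (h : ℝ) :
    Tendsto (fun m => ∫ t in (-π)..π, g t * dipole h m t) atTop (𝓝 ((g 0 - g h) / 2)) := by
  have h1 := tendsto_integral_peak_mul hg
  have h2 := tendsto_integral_peak_mul (g := fun t => g (t + h)) (by fun_prop)
  rw [zero_add] at h2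
  refine ((h1.sub h2).div_const 2).congr fun m => ?_
  have hc := continuous_peak m
  have h3 : ∫ t in (-π)..π, peak m (t - h) * g t = ∫ t in (-π)..π, peak m t * g (t + h) := by
    have hper : Function.Periodic (fun t => peak m t * g (t + h)) (2 * π) := fun t => by
      simp only
      rw [periodic_peak m t, show t + 2 * π + h = t + h + 2 * π by ring, hp]
    have := integral_comp_sub_of_periodic hper h
    simpa only [sub_add_cancel] using this
  have h4 : ∀ t, g t * dipole h m t =
      (2 * peakMass m)⁻¹ * (peak m t * g t - peak m (t - h) * g t) := fun t => by
    rw [dipole]; ring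
  simp_rw [h4]
  rw [intervalIntegral.integral_const_mul, integral_sub
    (Continuous.intervalIntegrable (by fun_prop) _ _)
    (Continuous.intervalIntegrable (by fun_prop) _ _), h3, mul_inv]
  ring

/-- The limit is the squared coefficient of (δ_0 - δ_h)/2: |1 - e^{ikh}|²/4 = sin²(kh/2), with β
dropping out of the modulus. -/
theorem tendsto_phase_dipole (β h : ℝ) (k : ℕ) :
    Tendsto (fun m => phaseCos β (dipole h m) k ^ 2 + phaseSin β (dipole h m) k ^ 2) atTop
      (𝓝 (1 / π ^ 2 * sin (k * h / 2) ^ 2)) := by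
  have h1 := (tendsto_integral_mul_dipole (g := fun t => cos (k * t + β * π / 2)) (by fun_prop)
    (fun t => by
      simp only
      rw [mul_add, add_right_comm, cos_add_nat_mul_two_pi]) h).const_mul (1 / π)
  have h2 := (tendsto_integral_mul_dipole (g := fun t => sin (k * t + β * π / 2)) (by fun_prop)
    (fun t => by
      simp only
      rw [mul_add, add_right_comm, sin_add_nat_mul_two_pi]) h).const_mul (1 / π)
  have h3 := (h1.pow 2).add (h2.pow 2)
  have e : (1 / π * ((cos (k * 0 + β * π / 2) - cos (k * h + β * π / 2)) / 2)) ^ 2 +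
      (1 / π * ((sin (k * 0 + β * π / 2) - sin (k * h + β * π / 2)) / 2)) ^ 2 =
      1 / π ^ 2 * sin (k * h / 2) ^ 2 := by
    rw [mul_zero, zero_add, show k * h = 2 * (k * h / 2) by ring]
    rw [show 2 * ((k : ℝ) * h / 2) / 2 = k * h / 2 by ring]
    set y := (k : ℝ) * h / 2
    set θ := β * π / 2
    rw [cos_sub_cos, sin_sub_sin, show (θ - (2 * y + θ)) / 2 = -y by ring, sin_neg]
    have := sin_sq_add_cos_sq ((θ + (2 * y + θ)) / 2)
    set z := (θ + (2 * y + θ)) / 2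
    field_simp
    linear_combination (sin y) ^ 2 * this
  rw [← e]
  exact h3

theorem le_fourierDeviation {α r β : ℝ} (hα : 0 < α) (hr : 0 < r) {n : ℕ} (hn : 1 ≤ n) (h : ℝ) :
    ENNReal.ofReal √(1 / π * ∑' k, decay α r (k + n) ^ 2 * sin ((k + n : ℕ) * h / 2) ^ 2) ≤
      fourierDeviation n α r β 1 2 := by
  set D := fourierDeviation n α r β 1 2 with hD
  rcases eq_or_ne D ⊤ with htop | htop
  · rw [htop]; exact le_top
  rw [ENNReal.ofReal_le_iff_le_toReal htop]
  refine sqrt_le_iff.2 ⟨ENNReal.toReal_nonneg, ?_⟩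
  have hs : Summable fun k => decay α r (k + n) ^ 2 * sin ((k + n : ℕ) * h / 2) ^ 2 :=
    Summable.of_nonneg_of_le (fun k => by positivity)
      (fun k => mul_le_of_le_one_right (sq_nonneg _) (sin_sq_le_one _))
      (summable_decay_sq hα hr n)
  rw [← tsum_mul_left]
  -- Convergence of the coefficients is only termwise in m, so the limit is taken in finite sums,
  -- each bounded by the full functional at the same dipole.
  refine (hs.mul_left _).tsum_le_of_sum_range_le fun N => ?_
  have ht : Tendsto (fun m => ∑ k ∈ Finset.range N, π * (decay α r (k + n) ^ 2 *
      (phaseCos β (dipole h m) (k + n) ^ 2 + phaseSin β (dipole h m) (k + n) ^ 2))) atTop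
      (𝓝 (∑ k ∈ Finset.range N, π * (decay α r (k + n) ^ 2 *
        (1 / π ^ 2 * sin ((k + n : ℕ) * h / 2) ^ 2)))) :=
    tendsto_finsetSum _ fun k _ => ((tendsto_phase_dipole β h (k + n)).const_mul _).const_mul _
  have e : ∑ k ∈ Finset.range N, 1 / π * (decay α r (k + n) ^ 2 *
      sin ((k + n : ℕ) * h / 2) ^ 2) = ∑ k ∈ Finset.range N, π * (decay α r (k + n) ^ 2 *
        (1 / π ^ 2 * sin ((k + n : ℕ) * h / 2) ^ 2)) :=
    Finset.sum_congr rfl fun k _ => by field_simp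
  rw [e]
  refine le_of_tendsto' ht fun m => ?_
  have hφ := dipole_mem_unitBall h m
  have hi := intervalIntegrable_of_mem_unitBall hφ
  have h1 := integral_abs_le_of_mem_unitBall hφ
  have hsum : Summable fun k => decay α r (k + n) ^ 2 *
      (phaseCos β (dipole h m) (k + n) ^ 2 + phaseSin β (dipole h m) (k + n) ^ 2) :=
    Summable.of_nonneg_of_le (fun k => by positivity)
      (fun k => mul_le_mul_of_nonneg_left (phaseCos_sq_add_phaseSin_sq_le hi h1 _) (sq_nonneg _))
      ((summable_decay_sq hα hr n).mul_right (1 / π ^ 2))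
  have h2 : ENNReal.ofReal (tailNorm α r β (dipole h m) n) ≤ D := by
    rw [hD, fourierDeviation_eq_iSup hα hr hn]
    exact le_iSup₂_of_le (f := fun φ (_ : φ ∈ unitBallZeroMean 1) =>
      ENNReal.ofReal (tailNorm α r β φ n)) _ hφ le_rfl
  rw [ENNReal.ofReal_le_iff_le_toReal htop, tailNorm,
    sqrt_le_left ENNReal.toReal_nonneg] at h2
  refine le_trans ?_ h2
  rw [← Finset.mul_sum]
  exact mul_le_mul_of_nonneg_left (hsum.sum_le_tsum _ fun k _ => by positivity) pi_pos.le

/-! ### Estimates for the tail sums -/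

section Sums

variable {a r : ℝ}

/-- Comparison of the tail of `∑ e^{-a k^r}` with the leading term of the tail integral. -/
theorem tsum_decay_succ_le (ha : 0 < a) (hr0 : 0 < r) (hr1 : r < 1) {n : ℕ} (hn : 1 ≤ n)
    (hδ : 1 / (a * r * (n : ℝ) ^ r) ≤ 1 / 2) :
    ∑' k, decay a r (k + (n + 1)) ≤ (1 + 2 * (1 / (a * r * (n : ℝ) ^ r))) *
      (decay a r n * (n : ℝ) ^ (1 - r) / (a * r)) := by
  set δ := 1 / (a * r * (n : ℝ) ^ r) with hδd
  have hn0 : (0 : ℝ) < n := by exact_mod_cast hn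
  have hδ0 : 0 < δ := by positivity
  -- G is the leading term of ∫_t^∞ e^{-a s^r} ds; -G' equals e^{-a t^r} up to a factor at least 1 -
  -- δ for t ≥ n.
  set G : ℝ → ℝ := fun t => exp (-a * t ^ r) * t ^ (1 - r) / (a * r) with hG
  have hder : ∀ t : ℝ, 0 < t →
      HasDerivAt G (-(exp (-a * t ^ r) * (1 - (1 - r) / (a * r) * t ^ (-r)))) t := by
    intro t ht
    have h1 := hasDerivAt_rpow_const (p := r) (Or.inl ht.ne')
    have h2 := hasDerivAt_rpow_const (p := 1 - r) (Or.inl ht.ne')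
    have h3 := (((h1.const_mul (-a)).exp).mul h2).div_const (a * r)
    refine h3.congr_deriv ?_
    rw [show 1 - r - 1 = -r by ring]
    have h4 : t ^ (r - 1) * t ^ (1 - r) = 1 := by rw [← rpow_add ht]; simp
    field_simp
    linear_combination (-a * r) * h4
  have hstep : ∀ k : ℕ, (1 - δ) * decay a r (k + (n + 1)) ≤ G ((n + k : ℕ) : ℝ) -
      G ((n + (k + 1) : ℕ) : ℝ) := by
    intro k
    set u : ℝ := ((n + k : ℕ) : ℝ) with hu
    have hun : (n : ℝ) ≤ u := by rw [hu]; push_cast; linarith [(Nat.cast_nonneg k : (0 : ℝ) ≤ k)]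
    have hv : ((n + (k + 1) : ℕ) : ℝ) = u + 1 := by rw [hu]; push_cast; ring
    -- The mean value theorem on [u, u + 1]: the summand at u + 1 is at most e^{-aξ^r}, so the
    -- differences of G dominate and telescope.
    obtain ⟨ξ, hξ, he⟩ := exists_hasDerivAt_eq_slope G _ (by linarith : u < u + 1)
      (fun t ht => (hder t (by linarith [ht.1])).continuousAt.continuousWithinAt)
      (fun t ht => hder t (by linarith [ht.1]))
    have hξ0 : 0 < ξ := by linarith [hξ.1]
    rw [add_sub_cancel_left, div_one] at he
    have h5 : (1 - r) / (a * r) * ξ ^ (-r) ≤ δ := by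
      have : ξ ^ (-r) ≤ (n : ℝ) ^ (-r) :=
        rpow_le_rpow_of_nonpos hn0 (by linarith [hξ.1]) (by linarith)
      calc (1 - r) / (a * r) * ξ ^ (-r) ≤ 1 / (a * r) * (n : ℝ) ^ (-r) := by
            gcongr; linarith
        _ = δ := by rw [hδd, rpow_neg hn0.le]; field_simp
    have h6 : decay a r (k + (n + 1)) ≤ exp (-a * ξ ^ r) := by
      rw [decay, show k + (n + 1) = n + (k + 1) by ring, hv]
      refine exp_le_exp.2 ?_
      have : ξ ^ r ≤ (u + 1) ^ r := rpow_le_rpow hξ0.le hξ.2.le hr0.le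
      nlinarith
    rw [hv]
    have h7 : (1 - δ) * decay a r (k + (n + 1)) ≤
        (1 - (1 - r) / (a * r) * ξ ^ (-r)) * exp (-a * ξ ^ r) :=
      mul_le_mul (by linarith) h6 (decay_pos _ _ _).le (by linarith)
    linarith
  have hs := summable_decay_add ha hr0 (n + 1)
  have hbound : (1 - δ) * ∑' k, decay a r (k + (n + 1)) ≤ G n := by
    rw [← tsum_mul_left]
    refine (hs.mul_left _).tsum_le_of_sum_range_le fun N => ?_
    refine (Finset.sum_le_sum fun k _ => hstep k).trans ?_
    rw [Finset.sum_range_sub' (fun k => G ((n + k : ℕ) : ℝ))]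
    have : 0 ≤ G ((n + N : ℕ) : ℝ) := by positivity
    simpa using this
  have hS : 0 ≤ ∑' k, decay a r (k + (n + 1)) := tsum_nonneg fun k => (decay_pos _ _ _).le
  -- The product is 1 + δ(1 - 2δ), which is where δ ≤ 1/2 enters.
  have hfac : 1 ≤ (1 + 2 * δ) * (1 - δ) := by nlinarith
  calc ∑' k, decay a r (k + (n + 1)) ≤
        (1 + 2 * δ) * (1 - δ) * ∑' k, decay a r (k + (n + 1)) :=
        le_mul_of_one_le_left hS hfac
    _ = (1 + 2 * δ) * ((1 - δ) * ∑' k, decay a r (k + (n + 1))) := by ring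
    _ ≤ _ := mul_le_mul_of_nonneg_left hbound (by positivity)

/-- Concavity of `t ↦ t^r` bounds `e^{-a k^r}` from below by a geometric progression. -/
theorem decay_mul_pow_le (ha : 0 < a) (hr0 : 0 < r) (hr1 : r < 1) {n : ℕ} (hn : 1 ≤ n) (k : ℕ) :
    decay a r n * exp (-(a * r / (n : ℝ) ^ (1 - r))) ^ k ≤ decay a r (k + n) := by
  have hn0 : (0 : ℝ) < n := by exact_mod_cast hn
  rw [decay, decay, ← exp_nat_mul, ← exp_add]
  refine exp_le_exp.2 ?_
  have h1 := rpow_one_add_le_one_add_mul_self (s := (k : ℝ) / n)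
    (by linarith [show (0 : ℝ) ≤ k / n by positivity]) hr0.le hr1.le
  have h2 : ((k + n : ℕ) : ℝ) ^ r = (n : ℝ) ^ r * (1 + k / n) ^ r := by
    rw [← mul_rpow hn0.le (by positivity)]
    congr 1; push_cast; field_simp; ring
  have h3 : (n : ℝ) ^ (1 - r) * (n : ℝ) ^ r = n := by
    rw [← rpow_add hn0]; simp
  have h4 : (n : ℝ) ^ r * (1 + r * (k / n)) = (n : ℝ) ^ r + k * (r / (n : ℝ) ^ (1 - r)) := by
    field_simp
    linear_combination (r * k) * h3
  have h5 : ((k + n : ℕ) : ℝ) ^ r ≤ (n : ℝ) ^ r + k * (r / (n : ℝ) ^ (1 - r)) := by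
    rw [h2, ← h4]
    exact mul_le_mul_of_nonneg_left h1 (by positivity)
  have h6 := mul_le_mul_of_nonneg_left h5 ha.le
  have h7 : a * ((n : ℝ) ^ r + k * (r / (n : ℝ) ^ (1 - r))) =
      a * (n : ℝ) ^ r + k * (a * r / (n : ℝ) ^ (1 - r)) := by ring
  linarith

/-- A lower bound for a geometric series with quadratically perturbed weights. -/
theorem le_tsum_geometric_mul {b c : ℝ} (hb0 : 0 < b) (hb1 : b ≤ 1) (hc : 0 ≤ c)
    (hcb : 8 * c ≤ b ^ 2) :
    (Summable fun k : ℕ => exp (-b) ^ k * (1 - c * (k : ℝ) ^ 2)) ∧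
      1 / b * (1 - 8 * c / b ^ 2) ≤ ∑' k : ℕ, exp (-b) ^ k * (1 - c * (k : ℝ) ^ 2) := by
  set q := exp (-b) with hq
  have hq0 : 0 < q := exp_pos _
  have hq1 : q < 1 := by rw [hq, exp_lt_one_iff]; linarith
  have hqle : 1 - q ≤ b := by linarith [add_one_le_exp (-b)]
  -- From e^b ≥ 1 + b one gets 1 - q ≥ b/(1 + b) ≥ b/2.
  have hqge : b / 2 ≤ 1 - q := by
    have h1 : q * (1 + b) ≤ 1 := by
      calc q * (1 + b) ≤ q * exp b := by
            gcongr; linarith [add_one_le_exp b]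
        _ = 1 := by rw [hq, ← exp_add]; simp
    nlinarith
  have hqn : ‖q‖ < 1 := by rw [Real.norm_eq_abs, abs_of_pos hq0]; exact hq1
  have h1 := hasSum_geometric_of_lt_one hq0.le hq1
  have h2 := (hasSum_choose_mul_geometric_of_norm_lt_one 2 hqn).mul_left 2
  -- Here k² ≤ (k + 1)(k + 2), whose power series sums to 2/(1 - q)³. This 2, times the 4 from 1/(1
  -- - q)² ≤ 4/b², is the constant 8.
  have hle : ∀ k : ℕ, q ^ k * (k : ℝ) ^ 2 ≤ 2 * (((k + 2).choose 2 : ℕ) * q ^ k) := by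
    intro k
    rw [Nat.cast_choose_two]
    push_cast
    have : 0 < q ^ k := by positivity
    have hk : (0 : ℝ) ≤ k := Nat.cast_nonneg k
    nlinarith [mul_nonneg this.le hk]
  have hs : Summable fun k : ℕ => q ^ k * (k : ℝ) ^ 2 :=
    Summable.of_nonneg_of_le (fun k => by positivity) hle h2.summable
  have h3 := hs.tsum_le_tsum hle h2.summable
  rw [h2.tsum_eq] at h3
  have h4 : HasSum (fun k : ℕ => q ^ k * (1 - c * (k : ℝ) ^ 2))
      ((1 - q)⁻¹ - c * ∑' k : ℕ, q ^ k * (k : ℝ) ^ 2) := by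
    have e : (fun k : ℕ => q ^ k * (1 - c * (k : ℝ) ^ 2)) =
        fun k : ℕ => q ^ k - c * (q ^ k * (k : ℝ) ^ 2) := by ext k; ring
    rw [e]
    exact h1.sub (hs.hasSum.mul_left c)
  refine ⟨h4.summable, ?_⟩
  rw [h4.tsum_eq]
  have hp : 0 < 1 - q := by linarith
  have h5 : c * ∑' k : ℕ, q ^ k * (k : ℝ) ^ 2 ≤ c * (2 * (1 / (1 - q) ^ (2 + 1))) :=
    mul_le_mul_of_nonneg_left h3 hc
  have h6 : 2 * c / (1 - q) ^ 2 ≤ 8 * c / b ^ 2 := by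
    rw [div_le_div_iff₀ (by positivity) (by positivity)]
    have : b ^ 2 ≤ 4 * (1 - q) ^ 2 := by nlinarith
    nlinarith
  have h7 : 0 ≤ 1 - 8 * c / b ^ 2 := by
    rw [sub_nonneg, div_le_one (by positivity)]; exact hcb
  calc 1 / b * (1 - 8 * c / b ^ 2) ≤ 1 / (1 - q) * (1 - 2 * c / (1 - q) ^ 2) := by
        refine mul_le_mul (one_div_le_one_div_of_le hp hqle) (by linarith) h7 (by positivity)
    _ = (1 - q)⁻¹ - c * (2 * (1 / (1 - q) ^ (2 + 1))) := by field_simp; ring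
    _ ≤ _ := by linarith

/-- The choice h = π/n turns the sine at frequency n + k into cos(πk/(2n)), whose square is at least
1 - (πk/(2n))². The geometric minorant has effective length 1/b, so the relative loss is of order
1/(nb)². -/
theorem le_tsum_decay_mul_sin_sq (ha : 0 < a) (hr0 : 0 < r) (hr1 : r < 1) {n : ℕ} (hn : 1 ≤ n)
    {b : ℝ} (hb : b = a * r / (n : ℝ) ^ (1 - r)) (hb1 : b ≤ 1)
    (hbn : 2 * π ^ 2 ≤ (n * b) ^ 2) :
    decay a r n / b * (1 - 2 * π ^ 2 / (n * b) ^ 2) ≤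
      ∑' k, decay a r (k + n) * sin ((k + n : ℕ) * (π / n) / 2) ^ 2 := by
  have hn0 : (0 : ℝ) < n := by exact_mod_cast hn
  have hb0 : 0 < b := by rw [hb]; positivity
  obtain ⟨hs, hle⟩ := le_tsum_geometric_mul (c := (π / (2 * n)) ^ 2) hb0 hb1 (sq_nonneg _) (by
    rw [mul_pow] at hbn
    rw [div_pow, ← mul_div_assoc, div_le_iff₀ (by positivity)]
    nlinarith)
  have hpt : ∀ k : ℕ, decay a r n * (exp (-b) ^ k * (1 - (π / (2 * n)) ^ 2 * (k : ℝ) ^ 2)) ≤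
      decay a r (k + n) * sin ((k + n : ℕ) * (π / n) / 2) ^ 2 := by
    intro k
    have h1 : ((k + n : ℕ) : ℝ) * (π / n) / 2 = π / (2 * n) * k + π / 2 := by
      push_cast; field_simp
    rw [h1, sin_add_pi_div_two]
    have h2 : 1 - (π / (2 * n)) ^ 2 * (k : ℝ) ^ 2 ≤ cos (π / (2 * n) * k) ^ 2 := by
      have := sin_sq_le_sq (x := π / (2 * n) * k)
      rw [mul_pow] at this
      linarith [sin_sq_add_cos_sq (π / (2 * n) * k)]
    rw [← mul_assoc]
    refine (mul_le_mul_of_nonneg_left h2 ?_).trans (mul_le_mul_of_nonneg_right ?_ (sq_nonneg _))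
    · have := decay_pos a r n; positivity
    · rw [hb]; exact decay_mul_pow_le ha hr0 hr1 hn k
  have hs2 : Summable fun k => decay a r (k + n) * sin ((k + n : ℕ) * (π / n) / 2) ^ 2 :=
    Summable.of_nonneg_of_le (fun k => mul_nonneg (decay_pos _ _ _).le (sq_nonneg _))
      (fun k => mul_le_of_le_one_right (decay_pos _ _ _).le (sin_sq_le_one _))
      (summable_decay_add ha hr0 n)
  have h3 := (hs.mul_left (decay a r n)).tsum_le_tsum hpt hs2
  rw [tsum_mul_left] at h3
  refine le_trans ?_ h3
  have h4 := mul_le_mul_of_nonneg_left hle (decay_pos a r n).le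
  refine Eq.trans_le ?_ h4
  have : 8 * (π / (2 * n)) ^ 2 / b ^ 2 = 2 * π ^ 2 / (n * b) ^ 2 := by field_simp; ring
  rw [this]; ring

end Sums

/-! ### Two-sided bounds and conclusion -/

/-- Beyond the threshold both small parameters are small. -/
theorem small_of_threshold_le {α r : ℝ} (hr0 : 0 < r) (hr1 : r < 1) (hα : 0 < α) {n : ℕ}
    (hn : threshold α r 2 ≤ n) :
    1 ≤ n ∧ 1 / (α * r * (n : ℝ) ^ r) ≤ 1 / 10 ∧ α * r / (n : ℝ) ^ (1 - r) ≤ 1 / 10 := by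
  obtain ⟨h1, h2⟩ := (isLeast_threshold (α := α) hr0 hr1 (p := 2) (by norm_num)).1
  set m := threshold α r 2
  have hm0 : (0 : ℝ) < m := by exact_mod_cast h1
  have hmn : (m : ℝ) ≤ n := by exact_mod_cast hn
  -- The crude bound π ≥ 1 suffices: only smallness to within 1/10 is needed later.
  have hb : thresholdBound 2 ≤ 1 / 10 := by
    have : (27 : ℝ) ≤ (3 * π) ^ 3 := by
      rw [mul_pow]
      have := one_le_pow₀ (n := 3) (by linarith [pi_gt_three] : (1 : ℝ) ≤ π)
      linarith
    have h3 : 1 / (3 * π) ^ 3 ≤ 1 / 27 := one_div_le_one_div_of_le (by norm_num) this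
    simp only [thresholdBound, ENNReal.toReal_ofNat]
    rw [if_neg (by norm_num), if_neg (by norm_num)]
    linarith
  have hchi : chi 2 = 2 := by simp [chi]
  rw [hchi] at h2
  have e1 : 1 / (α * r) * (1 / (m : ℝ) ^ r) = 1 / (α * r * (m : ℝ) ^ r) := by field_simp
  have e2 : α * r * 2 / (m : ℝ) ^ (1 - r) = 2 * (α * r / (m : ℝ) ^ (1 - r)) := by ring
  rw [e1, e2] at h2
  have p1 : 0 < 1 / (α * r * (m : ℝ) ^ r) := by positivity
  have p2 : 0 < α * r / (m : ℝ) ^ (1 - r) := by positivity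
  refine ⟨h1.trans hn, ?_, ?_⟩
  · have : 1 / (α * r * (n : ℝ) ^ r) ≤ 1 / (α * r * (m : ℝ) ^ r) := by gcongr
    linarith
  · have : α * r / (n : ℝ) ^ (1 - r) ≤ α * r / (m : ℝ) ^ (1 - r) := by
      gcongr
    linarith

/-- Two-sided bounds for the deviation in terms of its leading term. -/
theorem fourierDeviation_bounds {α r : ℝ} (β : ℝ) (hr0 : 0 < r) (hr1 : r < 1) (hα : 0 < α) {n : ℕ}
    (hn : 1 ≤ n) {A B M : ℝ} (hAd : A = 1 / (α * r * (n : ℝ) ^ r))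
    (hBd : B = α * r / (n : ℝ) ^ (1 - r)) (hA : A ≤ 1 / 10) (hB : B ≤ 1 / 10) (hM : 0 ≤ M)
    (hM2 : M ^ 2 = decay α r n ^ 2 / (2 * π * B)) :
    fourierDeviation n α r β 1 2 ≠ ⊤ ∧
      M * (1 - A) ≤ (fourierDeviation n α r β 1 2).toReal ∧
      (fourierDeviation n α r β 1 2).toReal ≤ M * (1 + B + A) := by
  have hn0 : (0 : ℝ) < n := by exact_mod_cast hn
  have hA0 : 0 < A := by rw [hAd]; positivity
  have hB0 : 0 < B := by rw [hBd]; positivity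
  have hc := decay_pos α r n
  -- This identity turns the window loss 1/(nB)² into A².
  have hAB : n * B * A = 1 := by
    have h3 : (n : ℝ) ^ (1 - r) * (n : ℝ) ^ r = n := by
      rw [← rpow_add hn0]; simp
    rw [hAd, hBd]
    field_simp
    linarith
  -- Squaring doubles α, so the tail estimates apply with A/2 and 2B in place of A and B.
  have hsq : ∀ k, decay α r k ^ 2 = decay (2 * α) r k := fun k => by rw [decay_sq, decay]
  have hup := fourierDeviation_le (β := β) hα hr0 hn
  have hlo := le_fourierDeviation (β := β) hα hr0 hn (π / n)
  have hfin : fourierDeviation n α r β 1 2 ≠ ⊤ := ne_top_of_le_ne_top ENNReal.ofReal_ne_top hup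
  refine ⟨hfin, ?_, ?_⟩
  · rw [ENNReal.ofReal_le_iff_le_toReal hfin] at hlo
    refine le_trans (le_sqrt_of_sq_le ?_) hlo
    have hnB : (n : ℝ) * (2 * B) = 2 / A := by
      field_simp; linarith
    have hπ : π ^ 2 ≤ 16 := by nlinarith [pi_le_four, pi_pos]
    have hb := le_tsum_decay_mul_sin_sq (a := 2 * α) (b := 2 * B) (by positivity) hr0 hr1 hn
      (by rw [hBd]; ring) (by linarith) (by
        rw [hnB, div_pow, le_div_iff₀ (by positivity)]
        nlinarith)
    simp_rw [hsq]
    rw [hnB] at hb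
    have e : 2 * π ^ 2 / (2 / A) ^ 2 = π ^ 2 / 2 * A ^ 2 := by field_simp
    rw [e] at hb
    -- Equivalent to A(1 + π²/2) ≤ 2, which follows from π² ≤ 16 and A ≤ 1/10.
    have h1 : (1 - A) ^ 2 ≤ 1 - π ^ 2 / 2 * A ^ 2 := by nlinarith [mul_pos hA0 hA0]
    calc (M * (1 - A)) ^ 2 = decay α r n ^ 2 / (2 * π * B) * (1 - A) ^ 2 := by
          rw [mul_pow, hM2]
      _ ≤ decay α r n ^ 2 / (2 * π * B) * (1 - π ^ 2 / 2 * A ^ 2) :=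
          mul_le_mul_of_nonneg_left h1 (by positivity)
      _ = 1 / π * (decay (2 * α) r n / (2 * B) * (1 - π ^ 2 / 2 * A ^ 2)) := by
          rw [hsq]; field_simp
      _ ≤ _ := mul_le_mul_of_nonneg_left hb (by positivity)
  · refine (ENNReal.toReal_le_of_le_ofReal (sqrt_nonneg _) hup).trans ?_
    refine sqrt_le_iff.2 ⟨by positivity, ?_⟩
    simp_rw [hsq]
    have e1 : 1 / (2 * α * r * (n : ℝ) ^ r) = A / 2 := by rw [hAd]; field_simp
    have hs := tsum_decay_succ_le (a := 2 * α) (by positivity) hr0 hr1 hn (by rw [e1]; linarith)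
    rw [e1] at hs
    have e2 : decay (2 * α) r n * (n : ℝ) ^ (1 - r) / (2 * α * r) =
        decay (2 * α) r n / (2 * B) := by rw [hBd]; field_simp
    rw [e2] at hs
    -- The comparison bounds the terms beyond n; the split-off term k = n accounts for the 2B below.
    have hsum := (summable_decay_add (by positivity : 0 < 2 * α) hr0 n).tsum_eq_zero_add
    have e3 : ∀ k, k + 1 + n = k + (n + 1) := fun k => by ring
    simp_rw [e3, zero_add] at hsum
    have hd := decay_pos (2 * α) r n
    calc 1 / π * ∑' k, decay (2 * α) r (k + n) ≤
          1 / π * (decay (2 * α) r n + (1 + 2 * (A / 2)) * (decay (2 * α) r n / (2 * B))) := by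
          rw [hsum]; gcongr
      _ = decay α r n ^ 2 / (2 * π * B) * (1 + 2 * B + A) := by rw [hsq]; field_simp; ring
      _ ≤ decay α r n ^ 2 / (2 * π * B) * (1 + B + A) ^ 2 :=
          mul_le_mul_of_nonneg_left (by nlinarith [mul_pos hA0 hB0]) (by positivity)
      _ = (M * (1 + B + A)) ^ 2 := by rw [mul_pow, hM2]

end GenPoisson

end

theorem mainTheorem4 (r α β : ℝ) (hr0 : 0 < r) (hr1 : r < 1) (hα : 0 < α)
    (n : ℕ) (hn : GenPoisson.threshold α r 2 ≤ n) :
    GenPoisson.fourierDeviation n α r β 1 2 ≠ ⊤ ∧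
    ∃ γ : ℝ, |γ| ≤ 392 * Real.pi ^ (5 / 2 : ℝ) ∧
      (GenPoisson.fourierDeviation n α r β 1 2).toReal =
        Real.exp (-α * (n : ℝ) ^ r) / Real.sqrt (2 * Real.pi * α * r) *
          (n : ℝ) ^ ((1 - r) / 2) *
          (1 + γ * ((α * r + Real.sqrt (α * r)) * (1 / (n : ℝ) ^ ((1 - r) / 2)) +
            Real.sqrt 2 / (α * r) * (1 / (n : ℝ) ^ r))) := by
  have hπ := Real.pi_pos
  obtain ⟨hn1, hA, hB⟩ := GenPoisson.small_of_threshold_le hr0 hr1 hα hn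
  have hn0 : (0 : ℝ) < n := by exact_mod_cast hn1
  have hn1' : (1 : ℝ) ≤ n := by exact_mod_cast hn1
  set M := Real.exp (-α * (n : ℝ) ^ r) / Real.sqrt (2 * Real.pi * α * r) *
    (n : ℝ) ^ ((1 - r) / 2) with hM
  set x := (n : ℝ) ^ ((1 - r) / 2) with hx
  have hx1 : 1 ≤ x := Real.one_le_rpow hn1' (by linarith)
  have hx2 : (n : ℝ) ^ (1 - r) = x ^ 2 := by
    rw [hx, ← Real.rpow_natCast, ← Real.rpow_mul hn0.le]
    congr 1; push_cast; ring
  have hM0 : 0 < M := by positivity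
  have hM2 : M ^ 2 = GenPoisson.decay α r n ^ 2 /
      (2 * Real.pi * (α * r / (n : ℝ) ^ (1 - r))) := by
    rw [hM, hx2, mul_pow, div_pow, Real.sq_sqrt (by positivity), GenPoisson.decay]
    field_simp
  obtain ⟨hfin, hlo, hup⟩ :=
    GenPoisson.fourierDeviation_bounds β hr0 hr1 hα hn1 rfl rfl hA hB hM0.le hM2
  refine ⟨hfin, ?_⟩
  set D := (GenPoisson.fourierDeviation n α r β 1 2).toReal
  set E := (α * r + Real.sqrt (α * r)) * (1 / x) + Real.sqrt 2 / (α * r) * (1 / (n : ℝ) ^ r)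
    with hE
  have hE0 : 0 < E := by positivity
  have hAE : 1 / (α * r * (n : ℝ) ^ r) ≤ Real.sqrt 2 / (α * r) * (1 / (n : ℝ) ^ r) := by
    rw [div_mul_div_comm, mul_one]
    have : 1 ≤ Real.sqrt 2 := Real.one_le_sqrt.2 (by norm_num)
    gcongr
  -- Since x ≥ 1, the error αr/x² is already dominated by αr/x.
  have hBE : α * r / (n : ℝ) ^ (1 - r) ≤ (α * r + Real.sqrt (α * r)) * (1 / x) := by
    rw [hx2, mul_one_div]
    have : x ≤ x ^ 2 := by nlinarith
    have h2 : 0 ≤ Real.sqrt (α * r) := Real.sqrt_nonneg _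
    gcongr
    linarith
  have hB0 : 0 < α * r / (n : ℝ) ^ (1 - r) := by positivity
  have habs : |D / M - 1| ≤ E := by
    rw [abs_le]
    constructor
    · have : 1 - 1 / (α * r * (n : ℝ) ^ r) ≤ D / M := by
        rw [le_div_iff₀ hM0]; linarith
      linarith
    · have : D / M ≤ 1 + α * r / (n : ℝ) ^ (1 - r) + 1 / (α * r * (n : ℝ) ^ r) := by
        rw [div_le_iff₀ hM0]; linarith
      linarith
  -- γ is obtained by solving the asserted identity; the bounds give |γ| ≤ 1, well inside the stated
  -- constant.
  refine ⟨(D / M - 1) / E, ?_, ?_⟩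
  · have h1 : |(D / M - 1) / E| ≤ 1 := by
      rw [abs_div, abs_of_pos hE0, div_le_one hE0]; exact habs
    have h2 : 1 ≤ Real.pi ^ (5 / 2 : ℝ) :=
      Real.one_le_rpow (by linarith [Real.pi_gt_three]) (by norm_num)
    linarith
  · rw [div_mul_cancel₀ _ hE0.ne']
    field_simp
    ring
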